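/- Let $A_2=\{x\in\mathbb Z^3 : x_1+x_2+x_3=0\}$ be the $A_2$ root lattice with the standard inner product, $A_2^*$ its dual lattice in $\mathbb R\otimes A_2$, and $A_2\oplus A_2$ the orthogonal direct sum. Write $r^2=(r,r)$. For $\tau$ in the upper half-plane put $q=e^{2\pi i\tau}$, $q^a=e^{2\pi i a\tau}$ for $a\in\mathbb R$, and $\varepsilon=e^{2\pi i/3}$. Let $\eta(q)=q^{1/24}\prod_{n\ge1}(1-q^n)$ be the Dedekind eta function. In terms of $\tau$ the symbols $\eta(q^m)$, $\eta(\varepsilon^jq^{1/3})$ and $\eta((\varepsilon^jq^{1/3})^2)$ denote the values of $\eta$ at the points $m\tau$, $(\tau+j)/3$ and $2(\tau+j)/3$ of the upper half-plane. For $r\in A_2^*\oplus A_2^*$ let $\delta(r)=1$ if $r\in A_2\oplus A_2$ and $\delta(r)=0$ otherwise, and let \[ \theta_{r+A_2\oplus A_2}(q)=\sum_{x\in r+A_2\oplus A_2} q^{x^2/2} . \] Then for every $r\in A_2^*\oplus A_2^*$ and every $\tau$ in the upper half-plane this series converges absolutely and \[ \theta_{r+ A_2\oplus A_2}(q) = \frac{1}{4}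 \, \frac{\eta(q)^{12}}{\eta(q^2)^6} \left\{ \frac{\eta(q^6)^2}{\eta(q^3)^4}\,\delta(r) + \sum_{j=0}^2 \varepsilon^{-3jr^2/2}\, \frac{ \eta\left( (\varepsilon^jq^{1/3})^2 \right)^2 } { \eta\left( \varepsilon^jq^{1/3} \right)^4 } \right\} . \] -/

import Mathlib

namespace CosetTheta

/-- The root lattice `A₂ = {x ∈ ℤ³ : x₀ + x₁ + x₂ = 0}` inside Euclidean space `ℝ³`. -/
def A2 : Submodule ℤ (EuclideanSpace ℝ (Fin 3)) where
  carrier := {x | (∀ i, ∃ m : ℤ, x i = m) ∧ ∑ i, x i = 0}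
  zero_mem' := ⟨fun _ => ⟨0, by simp⟩, by simp⟩
  add_mem' := by
    rintro x y ⟨hx, hx0⟩ ⟨hy, hy0⟩
    refine ⟨fun i => ?_, ?_⟩
    · obtain ⟨a, ha⟩ := hx i
      obtain ⟨b, hb⟩ := hy i
      exact ⟨a + b, by simp [ha, hb]⟩
    · simp [Finset.sum_add_distrib, hx0, hy0]
  smul_mem' := by
    rintro c x ⟨hx, hx0⟩
    refine ⟨fun i => ?_, ?_⟩
    · obtain ⟨a, ha⟩ := hx i
      exact ⟨c * a, by simp [ha]⟩
    · simp [← Finset.mul_sum, hx0]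

section
variable {E F : Type*} [NormedAddCommGroup E] [InnerProductSpace ℝ E]
  [NormedAddCommGroup F] [InnerProductSpace ℝ F]

/-- The dual `L^*` of a lattice `L`: the vectors in the real span of `L`
having integral inner product with all elements of `L`. -/
def dual (L : Submodule ℤ E) : Submodule ℤ E where
  carrier := {x | x ∈ Submodule.span ℝ (L : Set E) ∧ ∀ y ∈ L, ∃ m : ℤ, inner ℝ x y = (m : ℝ)}
  zero_mem' := ⟨Submodule.zero_mem _, fun _ _ => ⟨0, by simp⟩⟩
  add_mem' := by
    rintro x y ⟨hx, hx'⟩ ⟨hy, hy'⟩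
    refine ⟨Submodule.add_mem _ hx hy, fun z hz => ?_⟩
    obtain ⟨a, ha⟩ := hx' z hz
    obtain ⟨b, hb⟩ := hy' z hz
    exact ⟨a + b, by simp [inner_add_left, ha, hb]⟩
  smul_mem' := by
    rintro c x ⟨hx, hx'⟩
    refine ⟨zsmul_mem hx c, fun z hz => ?_⟩
    obtain ⟨a, ha⟩ := hx' z hz
    refine ⟨c * a, ?_⟩
    rw [← Int.cast_smul_eq_zsmul ℝ c x, real_inner_smul_left, ha]
    push_cast
    rfl

/-- The orthogonal direct sum `L ⊕ M`, in the `L²` product of the ambient Euclidean spaces. -/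
def orthSum (L : Submodule ℤ E) (M : Submodule ℤ F) : Submodule ℤ (WithLp 2 (E × F)) where
  carrier := {x | x.fst ∈ L ∧ x.snd ∈ M}
  zero_mem' := ⟨L.zero_mem, M.zero_mem⟩
  add_mem' := fun hx hy => ⟨L.add_mem hx.1 hy.1, M.add_mem hx.2 hy.2⟩
  smul_mem' := fun c _ hx => ⟨L.smul_mem c hx.1, M.smul_mem c hx.2⟩

/-- The term `q ^ (x² / 2)` of a theta function, where `q = exp (2 π i τ)`
and `x² = ⟨x, x⟩`. -/
noncomputable def thetaTerm (x : E) (τ : ℂ) : ℂ :=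
  Complex.exp (2 * Real.pi * Complex.I * τ * ((inner ℝ x x / 2 : ℝ) : ℂ))

/-- The theta function `θ_{r+L}` of the coset `r + L`, `∑_{x ∈ r + L} q ^ (x² / 2)`. -/
noncomputable def theta (r : E) (L : Submodule ℤ E) (τ : ℂ) : ℂ :=
  ∑' v : L, thetaTerm (r + (v : E)) τ

open Classical in
/-- `δ(r) = 1` if `r ∈ L`, and `δ(r) = 0` otherwise. -/
noncomputable def delta (L : Submodule ℤ E) (r : E) : ℂ := if r ∈ L then 1 else 0

end

/-- `ε = exp (2 π i / 3)`. -/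
noncomputable def eps : ℂ := Complex.exp (2 * Real.pi * Complex.I / 3)

end CosetTheta

open Filter Topology Finset

/-! The sum over the orthogonal coset is a product of two theta functions of cosets of `A2` in its
dual. Up to sign only two such functions exist: T₀ for `A2` itself and T₁ for either nontrivial
coset. So the formula amounts to three identities, for T₀², T₀T₁ and T₁².

Put Q = q^{1/3}, ω = e^{2πi/3}, E(q) = ∏(1 - qⁿ). Splitting ∑(-1)ⁿQ^{n²} by n mod 3 gives A - 2B,
and Q ↦ ω^jQ turns B into ω^jB. The Jacobi triple product gives A - 2B = E(Q)²/E(Q²), whose inverse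
square is the eta quotient in the formula, and A + B = E(Q²)²E(q)/(E(Q)E(q²)). Cubing Euler's
pentagonal series gives E(Q)³ = E(q)(T₀ - T₁) (`eulerProd_pow_three`).

With φ = E(q)²/E(q²) these combine to (T₀ - ω^jT₁)φ = (A + ω^jB)(A - 2ω^jB)² for all j, hence T₀φ =
A³ + 4B³ and T₁φ = 3A²B. Moreover A∏_j(A - 2ω^jB) = φ⁴ (`exists_dissection`). The three identities
are then pure algebra in A, B, φ (`theta_algebra`). -/

/-- The Euler function `∏ (1 - q ^ n)`, the product being over `n ≥ 1`. -/
noncomputable def eulerProd (q : ℂ) : ℂ := ∏' n : ℕ, (1 - q ^ (n + 1))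

/-! ### Gaussian binomials and the q-binomial theorem -/

section QBinomial

variable {R : Type*} [CommRing R]

/-- Gaussian binomial coefficients. -/
def qChoose (x : R) : ℕ → ℕ → R
  | _, 0 => 1
  | 0, _ + 1 => 0
  | n + 1, k + 1 => qChoose x n k + x ^ (k + 1) * qChoose x n (k + 1)

/-- The finite product `(1 - x) (1 - x ^ 2) ⋯ (1 - x ^ n)`. -/
def qFact (x : R) (n : ℕ) : R := ∏ i ∈ range n, (1 - x ^ (i + 1))

lemma qChoose_zero_right (x : R) (n : ℕ) : qChoose x n 0 = 1 := by
  cases n <;> rfl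

lemma qChoose_of_lt (x : R) (n : ℕ) : ∀ k, n < k → qChoose x n k = 0 := by
  induction n with
  | zero => rintro (_ | k) h <;> simp_all [qChoose]
  | succ n ih =>
    rintro (_ | k) h
    · simp at h
    · rw [qChoose, ih k (by omega), ih (k + 1) (by omega)]
      simp

lemma qChoose_self (x : R) (n : ℕ) : qChoose x n n = 1 := by
  induction n with
  | zero => rfl
  | succ n ih => rw [qChoose, ih, qChoose_of_lt x n (n + 1) (by omega)]; simp

lemma qFact_succ (x : R) (n : ℕ) : qFact x (n + 1) = qFact x n * (1 - x ^ (n + 1)) :=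
  prod_range_succ _ _

/-- The quotient formula for Gaussian binomials, kept free of division so that it follows over any
commutative ring by a double induction on the Pascal recursion. -/
lemma qChoose_mul_qFact (x : R) (n k : ℕ) :
    qChoose x (n + k) k * (qFact x k * qFact x n) = qFact x (n + k) := by
  induction k generalizing n with
  | zero => simp [qChoose_zero_right, qFact]
  | succ k ihk =>
    induction n with
    | zero => simp [qChoose_self, qFact]
    | succ n ihn =>
      have h1 := ihk (n + 1)
      rw [show n + 1 + (k + 1) = (n + 1 + k) + 1 by ring, qChoose, qFact_succ x (n + 1 + k)]
      rw [show n + (k + 1) = n + 1 + k by ring] at ihn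
      have e1 : qFact x (k + 1) = qFact x k * (1 - x ^ (k + 1)) := qFact_succ _ _
      have e2 : qFact x (n + 1) = qFact x n * (1 - x ^ (n + 1)) := qFact_succ _ _
      have e3 : x ^ (n + 1 + k + 1) = x ^ (n + 1) * x ^ (k + 1) := by ring
      rw [e3]
      linear_combination (1 - x ^ (k + 1)) * h1 + x ^ (k + 1) * (1 - x ^ (n + 1)) * ihn +
        qChoose x (n + 1 + k) k * qFact x (n + 1) * e1 +
        x ^ (k + 1) * qChoose x (n + 1 + k) (k + 1) * qFact x (k + 1) * e2

/-- The `q`-binomial theorem. -/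
lemma prod_one_add_mul_pow (x y : R) (n : ℕ) :
    ∏ k ∈ range n, (1 + y * x ^ k) =
      ∑ m ∈ range (n + 1), x ^ (m.choose 2) * y ^ m * qChoose x n m := by
  induction n generalizing y with
  | zero => simp [qChoose]
  | succ n ih =>
    have h1 : ∏ k ∈ range n, (1 + y * x ^ (k + 1)) = ∏ k ∈ range n, (1 + (y * x) * x ^ k) :=
      prod_congr rfl fun k _ => by ring
    have h2 : ∀ m, x ^ ((m + 1).choose 2) * y ^ (m + 1) * qChoose x (n + 1) (m + 1) =
        x ^ ((m + 1).choose 2) * (y * x) ^ (m + 1) * qChoose x n (m + 1) +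
        x ^ (m.choose 2) * (y * x) ^ m * qChoose x n m * y := fun m => by
      rw [qChoose, Nat.choose_succ_succ' m 1, Nat.choose_one_right]
      ring
    have h3 : ∑ m ∈ range (n + 1), x ^ (m.choose 2) * (y * x) ^ m * qChoose x n m =
        ∑ m ∈ range (n + 1), x ^ ((m + 1).choose 2) * (y * x) ^ (m + 1) * qChoose x n (m + 1)
          + 1 := by
      rw [sum_range_succ', sum_range_succ _ n, qChoose_of_lt x n (n + 1) (by omega)]
      simp [qChoose_zero_right]
    rw [prod_range_succ', h1, ih, sum_range_succ' _ (n + 1), sum_congr rfl fun m _ => h2 m,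
      sum_add_distrib, ← sum_mul, pow_zero, mul_one, mul_add, mul_one]
    nth_rewrite 1 [h3]
    simp [qChoose_zero_right]
    ring

end QBinomial

/-! ### The Jacobi triple product, from its finite form -/

/-- The finite form of the Jacobi triple product. -/
lemma prod_one_add_mul_one_add_inv {q z : ℂ} (hq : q ≠ 0) (hz : z ≠ 0) (n : ℕ) :
    ∏ k ∈ range n, ((1 + z * q ^ (2 * k + 1)) * (1 + z⁻¹ * q ^ (2 * k + 1))) =
      ∑ m ∈ range (2 * n + 1), q ^ (((m : ℤ) - n) ^ 2) * z ^ ((m : ℤ) - n) *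
        qChoose (q ^ 2) (2 * n) m := by
  -- This choice gives the 2n factors the odd exponents 1 - 2n, …, 2n - 1. Multiplying by ∏
  -- z⁻¹q^{2k+1} turns the n factors with negative exponent into 1 + z⁻¹q^{2k+1}.
  have key := prod_one_add_mul_pow (q ^ 2) (z * q ^ (1 - 2 * (n : ℤ))) (2 * n)
  have hc : ∀ n : ℕ, ∏ k ∈ range n, (z⁻¹ * q ^ (2 * k + 1)) = z ^ (-(n : ℤ)) * q ^ ((n : ℤ) ^ 2) := by
    intro n
    induction n with
    | zero => simp
    | succ n ih =>
      rw [prod_range_succ, ih, ← zpow_natCast q, ← zpow_neg_one z, mul_mul_mul_comm,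
        ← zpow_add₀ hz, ← zpow_add₀ hq]
      push_cast
      ring_nf
  have hl : (∏ k ∈ range (2 * n), (1 + z * q ^ (1 - 2 * (n : ℤ)) * (q ^ 2) ^ k)) *
      ∏ k ∈ range n, (z⁻¹ * q ^ (2 * k + 1)) =
      ∏ k ∈ range n, ((1 + z * q ^ (2 * k + 1)) * (1 + z⁻¹ * q ^ (2 * k + 1))) := by
    rw [two_mul, prod_range_add, ← prod_range_reflect _ n, mul_right_comm, ← prod_mul_distrib,
      mul_comm, ← prod_mul_distrib]
    refine prod_congr rfl fun k hk => ?_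
    have hk' : k < n := by simpa using hk
    congr 1
    · rw [← pow_mul, mul_assoc, ← zpow_natCast q (2 * (n + k)), ← zpow_add₀ hq,
        ← zpow_natCast q (2 * k + 1)]
      push_cast
      ring_nf
    · have e : q ^ (1 - 2 * (n : ℤ)) * (q ^ 2) ^ (n - 1 - k) = (q ^ (2 * k + 1))⁻¹ := by
        rw [← pow_mul, ← zpow_natCast q (2 * (n - 1 - k)), ← zpow_add₀ hq,
          ← zpow_natCast q (2 * k + 1), ← zpow_neg]
        congr 1
        push_cast [Nat.sub_sub, Nat.cast_sub (show 1 + k ≤ n by omega)]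
        ring
      rw [mul_assoc z, e]
      field_simp
      ring
  rw [← hl, key, hc, sum_mul]
  refine sum_congr rfl fun m _ => ?_
  have e : (q ^ 2) ^ (m.choose 2) = q ^ ((m : ℤ) * (m - 1)) := by
    rw [← pow_mul, ← zpow_natCast]
    congr 1
    have h2 : (m.choose 2) * 2 = m * (m - 1) := by
      rw [Nat.choose_two_right]
      exact Nat.div_mul_cancel (Nat.even_mul_pred_self m).two_dvd
    rcases m with _ | m
    · simp
    · push_cast
      simp only [Nat.add_sub_cancel] at h2
      have := congrArg (Nat.cast : ℕ → ℤ) h2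
      push_cast at this
      linarith
  rw [e, mul_pow, ← zpow_natCast, ← zpow_natCast, ← zpow_mul, sub_eq_add_neg (m : ℤ) n,
    zpow_add₀ hz, show ((m : ℤ) + -n) ^ 2 = (m * (m - 1)) + ((1 - 2 * (n : ℤ)) * m) + n ^ 2 by ring,
    zpow_add₀ hq, zpow_add₀ hq]
  ring

lemma summable_norm_pow_succ {q : ℂ} (hq : ‖q‖ < 1) : Summable fun n : ℕ => ‖q ^ (n + 1)‖ := by
  simpa using (summable_nat_add_iff 1).mpr (summable_geometric_of_lt_one (norm_nonneg q) hq)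

lemma eulerProd_ne_zero {q : ℂ} (hq : ‖q‖ < 1) : eulerProd q ≠ 0 := by
  refine tprod_one_add_ne_zero_of_summable (f := fun n : ℕ => -q ^ (n + 1)) (fun n h => ?_) ?_
  · have h1 : q ^ (n + 1) = 1 := by linear_combination -h
    have h2 : ‖q‖ ^ (n + 1) < 1 := pow_lt_one₀ (norm_nonneg q) hq (by omega)
    rw [← norm_pow, h1] at h2
    simp at h2
  · simpa using summable_norm_pow_succ hq

lemma tendsto_qFact {q : ℂ} (hq : ‖q‖ < 1) : Tendsto (qFact q) atTop (𝓝 (eulerProd q)) :=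
  (ModularForm.multipliable_one_sub_pow hq).tendsto_prod_tprod_nat

lemma qFact_ne_zero {q : ℂ} (hq : ‖q‖ < 1) (n : ℕ) : qFact q n ≠ 0 := by
  refine prod_ne_zero_iff.mpr fun i _ h => ?_
  have h1 : q ^ (i + 1) = 1 := by linear_combination -h
  have h2 : ‖q‖ ^ (i + 1) < 1 := pow_lt_one₀ (norm_nonneg q) hq (by omega)
  rw [← norm_pow, h1] at h2
  simp at h2

lemma exists_norm_le_of_tendsto {f : ℕ → ℂ} {a : ℂ} (h : Tendsto f atTop (𝓝 a)) :
    ∃ C, ∀ n, ‖f n‖ ≤ C := by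
  obtain ⟨C, hC⟩ := h.norm.bddAbove_range
  exact ⟨C, fun n => hC ⟨n, rfl⟩⟩

lemma qChoose_eq_div {q : ℂ} (hq : ‖q‖ < 1) {n m : ℕ} (h : m ≤ n) :
    qChoose q n m = qFact q n * (qFact q m)⁻¹ * (qFact q (n - m))⁻¹ := by
  have := qChoose_mul_qFact q (n - m) m
  rw [Nat.sub_add_cancel h] at this
  rw [← this]
  field_simp [qFact_ne_zero hq]

/-- The coefficient of `z ^ j * q ^ (j ^ 2)` in the finite Jacobi triple product. -/
noncomputable def tripleCoeff (x : ℂ) (n : ℕ) (j : ℤ) : ℂ :=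
  -- Extension by zero makes the finite sums into sums over ℤ, ready for dominated convergence.
  if j ∈ Icc (-(n : ℤ)) n then qChoose x (2 * n) (n + j).toNat else 0

/-- The bound is uniform in n and j because the finite products and their inverses converge to
nonzero limits; it supplies the dominating series. -/
lemma exists_norm_tripleCoeff_le {x : ℂ} (hx : ‖x‖ < 1) : ∃ C, ∀ n j, ‖tripleCoeff x n j‖ ≤ C := by
  obtain ⟨C, hC⟩ := exists_norm_le_of_tendsto (tendsto_qFact hx)
  obtain ⟨D, hD⟩ := exists_norm_le_of_tendsto ((tendsto_qFact hx).inv₀ (eulerProd_ne_zero hx))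
  have hC0 : 0 ≤ C := (norm_nonneg _).trans (hC 0)
  have hD0 : 0 ≤ D := (norm_nonneg _).trans (hD 0)
  refine ⟨C * D * D, fun n j => ?_⟩
  unfold tripleCoeff
  split_ifs with h
  · rw [mem_Icc] at h
    rw [qChoose_eq_div hx (by omega), norm_mul, norm_mul]
    gcongr
    exacts [hC _, hD _, hD _]
  · simp only [norm_zero]; positivity

lemma tendsto_tripleCoeff {x : ℂ} (hx : ‖x‖ < 1) (j : ℤ) :
    Tendsto (fun n => tripleCoeff x n j) atTop (𝓝 (eulerProd x)⁻¹) := by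
  have hE := eulerProd_ne_zero hx
  have h1 : Tendsto (fun n : ℕ => 2 * n) atTop atTop :=
    tendsto_atTop_mono (fun n => by simp only [id]; omega) tendsto_id
  have h2 : ∀ i : ℤ, Tendsto (fun n : ℕ => (n + i).toNat) atTop atTop := fun i => by
    refine tendsto_atTop.mpr fun b => ?_
    filter_upwards [eventually_ge_atTop (b + i.natAbs)] with n hn
    omega
  have h3 := (((tendsto_qFact hx).comp h1).mul (((tendsto_qFact hx).inv₀ hE).comp (h2 j))).mul
    (((tendsto_qFact hx).inv₀ hE).comp (h2 (-j)))
  rw [mul_inv_cancel₀ hE, one_mul] at h3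
  refine h3.congr' ?_
  filter_upwards [eventually_ge_atTop j.natAbs] with n hn
  rw [tripleCoeff, if_pos (by rw [mem_Icc]; omega), qChoose_eq_div hx (by omega)]
  simp only [Function.comp]
  congr 3
  omega

lemma prod_eq_tsum_tripleCoeff {q z : ℂ} (hq : q ≠ 0) (hz : z ≠ 0) (n : ℕ) :
    ∏ k ∈ range n, ((1 + z * q ^ (2 * k + 1)) * (1 + z⁻¹ * q ^ (2 * k + 1))) =
      ∑' j : ℤ, q ^ (j ^ 2) * z ^ j * tripleCoeff (q ^ 2) n j := by
  rw [tsum_eq_sum (s := Icc (-(n : ℤ)) n) (fun j hj => by simp [tripleCoeff, hj]),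
    prod_one_add_mul_one_add_inv hq hz]
  refine sum_nbij' (fun m : ℕ => (m : ℤ) - n) (fun j => (n + j).toNat) ?_ ?_ ?_ ?_ ?_
  · intro m hm
    simp only [mem_range, mem_Icc] at *
    omega
  · intro m hm
    simp only [mem_range, mem_Icc] at *
    omega
  · intro m hm
    omega
  · intro m hm
    simp only [mem_Icc] at *
    omega
  · intro m hm
    simp only [mem_range] at hm
    rw [tripleCoeff, if_pos (by rw [mem_Icc]; omega)]
    congr 2
    omega

lemma multipliable_one_add_mul_odd_pow {q : ℂ} (hq : ‖q‖ < 1) (z : ℂ) :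
    Multipliable fun k : ℕ => 1 + z * q ^ (2 * k + 1) := by
  refine multipliable_one_add_of_summable ?_
  simp only [norm_mul]
  exact ((summable_norm_pow_succ hq).comp_injective
    (i := fun k : ℕ => 2 * k) (fun a b h => by simpa using h)).mul_left _

/-- The **Jacobi triple product** identity. -/
theorem tsum_zpow_sq_mul_zpow {q z : ℂ} (hq0 : q ≠ 0) (hq : ‖q‖ < 1) (hz : z ≠ 0)
    (hs : Summable fun j : ℤ => q ^ (j ^ 2) * z ^ j) :
    ∑' j : ℤ, q ^ (j ^ 2) * z ^ j = eulerProd (q ^ 2) *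
      ((∏' k : ℕ, (1 + z * q ^ (2 * k + 1))) * ∏' k : ℕ, (1 + z⁻¹ * q ^ (2 * k + 1))) := by
  have hq2 : ‖q ^ 2‖ < 1 := by
    rw [norm_pow]
    exact pow_lt_one₀ (norm_nonneg q) hq two_ne_zero
  obtain ⟨C, hC⟩ := exists_norm_tripleCoeff_le hq2
  have h1 : Tendsto (fun n : ℕ => ∑' j : ℤ, q ^ (j ^ 2) * z ^ j * tripleCoeff (q ^ 2) n j) atTop
      (𝓝 (∑' j : ℤ, q ^ (j ^ 2) * z ^ j * (eulerProd (q ^ 2))⁻¹)) := by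
    refine tendsto_tsum_of_dominated_convergence (hs.norm.mul_right C)
      (fun j => (tendsto_tripleCoeff hq2 j).const_mul _) (.of_forall fun n j => ?_)
    rw [norm_mul]
    gcongr
    exact hC n j
  have h2 := (multipliable_one_add_mul_odd_pow hq z).tendsto_prod_tprod_nat.mul
    (multipliable_one_add_mul_odd_pow hq z⁻¹).tendsto_prod_tprod_nat
  simp_rw [← prod_eq_tsum_tripleCoeff hq0 hz, prod_mul_distrib] at h1
  rw [← tendsto_nhds_unique h1 h2, tsum_mul_right]
  field_simp [eulerProd_ne_zero hq2]

open Complex Real in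
/-- The Jacobi triple product for the two-variable theta function. -/
theorem jacobiTheta₂_eq_tprod (w : ℂ) {τ : ℂ} (hτ : 0 < τ.im) :
    jacobiTheta₂ w τ = eulerProd (cexp (π * I * τ) ^ 2) *
      ((∏' k : ℕ, (1 + cexp (2 * π * I * w) * cexp (π * I * τ) ^ (2 * k + 1))) *
        ∏' k : ℕ, (1 + (cexp (2 * π * I * w))⁻¹ * cexp (π * I * τ) ^ (2 * k + 1))) := by
  have h : ∀ j : ℤ, jacobiTheta₂_term j w τ =
      cexp (π * I * τ) ^ (j ^ 2) * cexp (2 * π * I * w) ^ j := fun j => by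
    rw [jacobiTheta₂_term, ← Complex.exp_int_mul, ← Complex.exp_int_mul, ← Complex.exp_add]
    push_cast
    ring_nf
  have hs := (summable_jacobiTheta₂_term_iff w τ).mpr hτ
  simp_rw [h] at hs
  simp_rw [jacobiTheta₂, h]
  refine tsum_zpow_sq_mul_zpow (Complex.exp_ne_zero _) ?_ (Complex.exp_ne_zero _) hs
  rw [Complex.norm_exp]
  have : (π * I * τ : ℂ).re = -(π * τ.im) := by simp
  rw [this, Real.exp_lt_one_iff]
  have := mul_pos Real.pi_pos hτ
  linarith

/-! ### Splitting Euler products modulo 2 and 3 -/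

lemma multipliable_one_sub_mul_pow {q : ℂ} (hq : ‖q‖ < 1) (z : ℂ) {g : ℕ → ℕ}
    (hg : Function.Injective g) : Multipliable fun k : ℕ => 1 - z * q ^ (g k + 1) := by
  refine (multipliable_one_add_of_summable (f := fun k : ℕ => -(z * q ^ (g k + 1))) ?_)
  simp only [norm_neg, norm_mul]
  exact ((summable_norm_pow_succ hq).comp_injective hg).mul_left _

lemma tprod_mod_three {f : ℕ → ℂ} (h : Multipliable f) (h0 : Multipliable fun k => f (3 * k))
    (h1 : Multipliable fun k => f (3 * k + 1)) (h2 : Multipliable fun k => f (3 * k + 2)) :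
    ∏' n, f n = (∏' k, f (3 * k)) * (∏' k, f (3 * k + 1)) * ∏' k, f (3 * k + 2) := by
  have h3 : Tendsto (fun n : ℕ => 3 * n) atTop atTop :=
    tendsto_atTop_mono (fun n => by simp only [id]; omega) tendsto_id
  refine tendsto_nhds_unique (h.tendsto_prod_tprod_nat.comp h3)
    (((h0.tendsto_prod_tprod_nat.mul h1.tendsto_prod_tprod_nat).mul
      h2.tendsto_prod_tprod_nat).congr fun n => ?_)
  simp only [Function.comp]
  induction n with
  | zero => simp
  | succ n ih =>
    rw [show 3 * (n + 1) = 3 * n + 1 + 1 + 1 by ring, prod_range_succ _ (3 * n + 1 + 1),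
      prod_range_succ _ (3 * n + 1), prod_range_succ _ (3 * n), ← ih]
    simp only [prod_range_succ]
    ring

lemma norm_pow_lt_one {q : ℂ} (hq : ‖q‖ < 1) {n : ℕ} (hn : n ≠ 0) : ‖q ^ n‖ < 1 := by
  rw [norm_pow]
  exact pow_lt_one₀ (norm_nonneg q) hq hn

lemma tprod_odd_mul_eulerProd {q : ℂ} (hq : ‖q‖ < 1) :
    (∏' k : ℕ, (1 - q ^ (2 * k + 1))) * eulerProd (q ^ 2) = eulerProd q := by
  have h0 := multipliable_one_sub_mul_pow hq 1 (g := fun k => 2 * k) fun a b h => by simpa using h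
  have h1 := multipliable_one_sub_mul_pow hq 1 (g := fun k => 2 * k + 1)
    fun a b h => by simpa using h
  simp only [one_mul] at h0 h1
  rw [eulerProd, eulerProd, ← tprod_even_mul_odd (f := fun n : ℕ => 1 - q ^ (n + 1)) h0 h1]
  congr 1
  exact tprod_congr fun k => by ring

lemma tprod_mod_three_eulerProd {q : ℂ} (hq : ‖q‖ < 1) :
    eulerProd q = (∏' k : ℕ, (1 - q ^ (3 * k + 1))) * (∏' k : ℕ, (1 - q ^ (3 * k + 2))) *
      eulerProd (q ^ 3) := by
  have h := multipliable_one_sub_mul_pow hq 1 (g := fun k => k) fun a b h => by simpa using h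
  have h0 := multipliable_one_sub_mul_pow hq 1 (g := fun k => 3 * k) fun a b h => by simpa using h
  have h1 := multipliable_one_sub_mul_pow hq 1 (g := fun k => 3 * k + 1)
    fun a b h => by simpa using h
  have h2 := multipliable_one_sub_mul_pow hq 1 (g := fun k => 3 * k + 2)
    fun a b h => by simpa using h
  simp only [one_mul] at h h0 h1 h2
  rw [eulerProd, tprod_mod_three (f := fun n : ℕ => 1 - q ^ (n + 1)) h h0 h1 h2]
  congr 1
  exact tprod_congr fun k => by ring

lemma prod_three_one_sub {ζ : ℂ} (hζ : 1 + ζ + ζ ^ 2 = 0) (y : ℂ) :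
    (1 - y) * (1 - ζ * y) * (1 - ζ ^ 2 * y) = 1 - y ^ 3 := by
  linear_combination (-y + y ^ 2 * ζ - y ^ 3 * (ζ - 1)) * hζ

/-- `∏_ζ E(ζ q) = E(q ^ 3) ^ 4 / E(q ^ 9)` for the Euler function `E`, the product being over
the cube roots of unity. -/
lemma prod_three_eulerProd {ζ : ℂ} (hζ : 1 + ζ + ζ ^ 2 = 0) {q : ℂ} (hq : ‖q‖ < 1) :
    eulerProd q * eulerProd (ζ * q) * eulerProd (ζ ^ 2 * q) * eulerProd (q ^ 9) =
      eulerProd (q ^ 3) ^ 4 := by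
  have hζ3 : ζ ^ 3 = 1 := by linear_combination (ζ - 1) * hζ
  have hn : ‖ζ‖ = 1 := by
    have : ‖ζ‖ ^ 3 = 1 := by rw [← norm_pow, hζ3, norm_one]
    exact (pow_eq_one_iff_of_nonneg (norm_nonneg _) (by norm_num)).mp this
  have hq1 : ‖ζ * q‖ < 1 := by rwa [norm_mul, hn, one_mul]
  have hq2 : ‖ζ ^ 2 * q‖ < 1 := by rwa [norm_mul, norm_pow, hn, one_pow, one_mul]
  have e1 : ∀ k : ℕ, (ζ * q) ^ (3 * k + 1) = ζ * q ^ (3 * k + 1) := fun k => by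
    rw [mul_pow, pow_succ ζ, pow_mul ζ, hζ3]; ring
  have e2 : ∀ k : ℕ, (ζ * q) ^ (3 * k + 2) = ζ ^ 2 * q ^ (3 * k + 2) := fun k => by
    rw [mul_pow, pow_add ζ, pow_mul ζ, hζ3]; ring
  have e3 : ∀ k : ℕ, (ζ ^ 2 * q) ^ (3 * k + 1) = ζ ^ 2 * q ^ (3 * k + 1) := fun k => by
    rw [mul_pow, ← pow_mul, show 2 * (3 * k + 1) = 3 * (2 * k) + 2 by ring, pow_add ζ, pow_mul ζ,
      hζ3]; ring
  have e4 : ∀ k : ℕ, (ζ ^ 2 * q) ^ (3 * k + 2) = ζ * q ^ (3 * k + 2) := fun k => by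
    rw [mul_pow, ← pow_mul, show 2 * (3 * k + 2) = 3 * (2 * k + 1) + 1 by ring, pow_add ζ,
      pow_mul ζ, hζ3]; ring
  have e5 : (ζ * q) ^ 3 = q ^ 3 := by rw [mul_pow, hζ3, one_mul]
  have e6 : (ζ ^ 2 * q) ^ 3 = q ^ 3 := by linear_combination q ^ 3 * (ζ ^ 3 + 1) * hζ3
  have m : ∀ (z : ℂ) (g : ℕ → ℕ), Function.Injective g →
      Multipliable fun k : ℕ => 1 - z * q ^ (g k + 1) :=
    fun z g hg => multipliable_one_sub_mul_pow hq z hg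
  have i1 : Function.Injective fun k : ℕ => 3 * k := fun a b h => by simpa using h
  have i2 : Function.Injective fun k : ℕ => 3 * k + 1 := fun a b h => by simpa using h
  -- For exponents prime to 3 the three twisted factors multiply to 1 - y³; exponents divisible by 3
  -- do not see ζ and contribute E(q³)³.
  have p1 : (∏' k : ℕ, (1 - q ^ (3 * k + 1))) * (∏' k : ℕ, (1 - ζ * q ^ (3 * k + 1))) *
      (∏' k : ℕ, (1 - ζ ^ 2 * q ^ (3 * k + 1))) = ∏' k : ℕ, (1 - (q ^ 3) ^ (3 * k + 1)) := by
    have m1 := m 1 _ i1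
    simp only [one_mul] at m1
    rw [← m1.tprod_mul (m ζ _ i1), ← (m1.mul (m ζ _ i1)).tprod_mul (m (ζ ^ 2) _ i1)]
    exact tprod_congr fun k => by rw [prod_three_one_sub hζ]; ring
  have p2 : (∏' k : ℕ, (1 - q ^ (3 * k + 2))) * (∏' k : ℕ, (1 - ζ * q ^ (3 * k + 2))) *
      (∏' k : ℕ, (1 - ζ ^ 2 * q ^ (3 * k + 2))) = ∏' k : ℕ, (1 - (q ^ 3) ^ (3 * k + 2)) := by
    have m1 := m 1 _ i2
    simp only [one_mul] at m1
    rw [← m1.tprod_mul (m ζ _ i2), ← (m1.mul (m ζ _ i2)).tprod_mul (m (ζ ^ 2) _ i2)]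
    exact tprod_congr fun k => by rw [prod_three_one_sub hζ]; ring
  have h3 := tprod_mod_three_eulerProd (norm_pow_lt_one hq three_ne_zero)
  rw [← pow_mul] at h3
  rw [tprod_mod_three_eulerProd hq, tprod_mod_three_eulerProd hq1, tprod_mod_three_eulerProd hq2,
    e5, e6]
  simp_rw [e1, e2, e3, e4]
  rw [← p1, ← p2, show 3 * 3 = 9 from rfl] at h3
  linear_combination -eulerProd (q ^ 3) ^ 3 * h3

/-! ### Product formulas for special theta values -/

open Complex Real

/-- The nome `exp (2 π i σ)`. -/
noncomputable def nome (σ : ℂ) : ℂ := cexp (2 * π * I * σ)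

lemma norm_nome_lt_one {σ : ℂ} (hσ : 0 < σ.im) : ‖nome σ‖ < 1 := by
  have h : (2 * π * I * σ : ℂ).re = -(2 * (π * σ.im)) := by simp; ring
  rw [nome, Complex.norm_exp, h, Real.exp_lt_one_iff]
  have := mul_pos Real.pi_pos hσ
  linarith

lemma nome_nat_mul (n : ℕ) (σ : ℂ) : nome (n * σ) = nome σ ^ n := by
  rw [nome, nome, ← Complex.exp_nat_mul]
  ring_nf

lemma nome_add (σ ρ : ℂ) : nome (σ + ρ) = nome σ * nome ρ := by
  rw [nome, nome, nome, ← Complex.exp_add]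
  ring_nf

lemma cexp_pi_mul_I_mul_two_mul (σ : ℂ) : cexp (π * I * (2 * σ)) = nome σ := by
  rw [nome]; ring_nf

lemma nome_half : nome (1 / 2) = -1 := by
  rw [nome, ← Complex.exp_pi_mul_I]; ring_nf

lemma nome_intCast (n : ℤ) : nome n = 1 := by
  rw [nome, ← Complex.exp_int_mul_two_pi_mul_I n]; ring_nf

lemma im_nat_mul_pos {σ : ℂ} (hσ : 0 < σ.im) {n : ℕ} (hn : n ≠ 0) : 0 < ((n : ℂ) * σ).im := by
  have : 0 < n := by omega
  simp; positivity

/-- Gauss's product for `∑ (-1) ^ n q ^ (n ^ 2)`. -/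
lemma jacobiTheta₂_half_mul_eulerProd {σ : ℂ} (hσ : 0 < σ.im) :
    jacobiTheta₂ (1 / 2) (2 * σ) * eulerProd (nome σ ^ 2) = eulerProd (nome σ) ^ 2 := by
  have h := jacobiTheta₂_eq_tprod (1 / 2) (im_nat_mul_pos hσ two_ne_zero)
  have hn : cexp (2 * π * I * (1 / 2)) = -1 := nome_half
  push_cast at h
  rw [cexp_pi_mul_I_mul_two_mul, hn, inv_neg, inv_one] at h
  simp_rw [neg_one_mul, ← sub_eq_add_neg] at h
  rw [h, ← tprod_odd_mul_eulerProd (norm_nome_lt_one hσ)]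
  ring

lemma one_add_nome_third : 1 + nome (1 / 3) + nome (1 / 3) ^ 2 = 0 := by
  have h := (Complex.isPrimitiveRoot_exp 3 three_ne_zero).geom_sum_eq_zero (by norm_num)
  have h2 : cexp (2 * π * I / (3 : ℕ)) = nome (1 / 3) := by rw [nome]; push_cast; ring_nf
  rw [h2] at h
  simpa [sum_range_succ] using h

lemma nome_third_pow_three : nome (1 / 3) ^ 3 = 1 := by
  linear_combination (nome (1 / 3) - 1) * one_add_nome_third

/-- Here z = -ω: the odd products twisted by ω and ω² are completed by the untwisted one to the odd
product in q³. -/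
lemma jacobiTheta₂_five_sixths_mul_eulerProd {σ : ℂ} (hσ : 0 < σ.im) :
    jacobiTheta₂ (1 / 2 + 1 / 3) (2 * σ) * (eulerProd (nome σ) * eulerProd (nome σ ^ 6)) =
      eulerProd (nome σ ^ 2) ^ 2 * eulerProd (nome σ ^ 3) := by
  have hq := norm_nome_lt_one hσ
  have h := jacobiTheta₂_eq_tprod (1 / 2 + 1 / 3) (im_nat_mul_pos hσ two_ne_zero)
  have hn : cexp (2 * π * I * (1 / 2 + 1 / 3)) = -nome (1 / 3) := by
    rw [← neg_one_mul, ← nome_half, ← nome_add, nome]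
  have hζ0 : nome (1 / 3) ≠ 0 := Complex.exp_ne_zero _
  have hi : (-nome (1 / 3))⁻¹ = -nome (1 / 3) ^ 2 := by
    field_simp
    linear_combination nome_third_pow_three
  push_cast at h
  rw [cexp_pi_mul_I_mul_two_mul, hn, hi] at h
  simp_rw [neg_mul, ← sub_eq_add_neg] at h
  have m : ∀ z : ℂ, Multipliable fun k : ℕ => 1 - z * nome σ ^ (2 * k + 1) :=
    fun z => multipliable_one_sub_mul_pow hq z (g := fun k => 2 * k) fun a b h => by simpa using h
  have m1 := m 1
  simp only [one_mul] at m1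
  have p : (∏' k : ℕ, (1 - nome σ ^ (2 * k + 1))) *
      (∏' k : ℕ, (1 - nome (1 / 3) * nome σ ^ (2 * k + 1))) *
      (∏' k : ℕ, (1 - nome (1 / 3) ^ 2 * nome σ ^ (2 * k + 1))) =
      ∏' k : ℕ, (1 - (nome σ ^ 3) ^ (2 * k + 1)) := by
    rw [← m1.tprod_mul (m _), ← (m1.mul (m _)).tprod_mul (m _)]
    exact tprod_congr fun k => by rw [prod_three_one_sub one_add_nome_third]; ring
  have h3 := tprod_odd_mul_eulerProd (norm_pow_lt_one hq three_ne_zero)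
  rw [← pow_mul, ← p] at h3
  rw [h, ← h3, ← tprod_odd_mul_eulerProd hq]
  ring

/-- Euler's pentagonal number theorem. -/
lemma jacobiTheta₂_pentagonal {σ : ℂ} (hσ : 0 < σ.im) :
    jacobiTheta₂ (1 / 2 + σ / 2) (3 * σ) = eulerProd (nome σ) := by
  have h := jacobiTheta₂_eq_tprod (1 / 2 + σ / 2) (im_nat_mul_pos hσ three_ne_zero)
  set p := nome (σ / 2) with hp
  have hp0 : p ≠ 0 := Complex.exp_ne_zero _
  have hn : cexp (2 * π * I * (1 / 2 + σ / 2)) = -p := by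
    rw [← neg_one_mul, ← nome_half, hp, ← nome_add, nome]
  have hp3 : cexp (π * I * (3 * σ)) = p ^ 3 := by
    rw [hp, nome, ← Complex.exp_nat_mul]; push_cast; ring_nf
  have hp2 : nome σ = p ^ 2 := by rw [hp, ← nome_nat_mul]; push_cast; ring_nf
  push_cast at h
  rw [hn, hp3] at h
  rw [h, tprod_mod_three_eulerProd (norm_nome_lt_one hσ), hp2]
  -- With q = p², the two products run over the exponents 2 and 1 mod 3, and the Euler factor of the
  -- triple product supplies those divisible by 3.
  have e1 : ∀ k : ℕ, 1 + -p * (p ^ 3) ^ (2 * k + 1) = 1 - (p ^ 2) ^ (3 * k + 2) := fun k => by ring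
  have e2 : ∀ k : ℕ, 1 + (-p)⁻¹ * (p ^ 3) ^ (2 * k + 1) = 1 - (p ^ 2) ^ (3 * k + 1) := fun k => by
    field_simp
    ring
  simp_rw [e1, e2]
  ring_nf

/-! ### Splitting the theta series modulo 3 -/

/-- The class of 2 is written as the negative of the class of 1, to exploit the symmetry n ↦ -n. -/
lemma tsum_int_mod_three {f : ℤ → ℂ} (hf : Summable f) :
    ∑' n, f n = ∑' k : ℤ, f (3 * k) + ∑' k : ℤ, f (3 * k + 1) + ∑' k : ℤ, f (-(3 * k + 1)) := by
  have hs : ∀ a b : ℤ, a ≠ 0 → Summable fun k : ℤ => f (a * k + b) := fun a b ha =>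
    hf.comp_injective (i := fun k : ℤ => a * k + b) fun x y h => by simpa [ha] using h
  rw [← (Int.divModEquiv 3).symm.tsum_eq]
  have hs' := (Int.divModEquiv 3).symm.summable_iff.mpr hf
  rw [Summable.tsum_prod (f := fun c => f ((Int.divModEquiv 3).symm c)) hs']
  simp only [Int.divModEquiv_symm_apply, Fin.sum_univ_three, tsum_fintype]
  have h0 := hs 3 0 (by norm_num)
  have h1 := hs 3 1 (by norm_num)
  have h2 := hs 3 2 (by norm_num)
  simp only [add_zero] at h0
  have e : ∑' k : ℤ, f (-(3 * k + 1)) = ∑' k : ℤ, f (3 * k + 2) := by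
    rw [← (Equiv.subLeft (-1 : ℤ)).tsum_eq]
    refine tsum_congr fun k => ?_
    congr 1
    simp
    ring
  rw [e, ← h0.tsum_add h1, ← (h0.add h1).tsum_add h2]
  refine tsum_congr fun k => ?_
  simp [mul_comm]

lemma nome_eq_of_eq_add_intCast {x y : ℂ} (n : ℤ) (h : x = y + n) : nome x = nome y := by
  rw [h, nome_add, nome_intCast, mul_one]

lemma jacobiTheta₂_term_eq_nome (n : ℤ) (w τ : ℂ) :
    jacobiTheta₂_term n w τ = nome (n * w + n ^ 2 * τ / 2) := by
  rw [jacobiTheta₂_term, nome]; ring_nf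

lemma nome_mul_nome (x y : ℂ) : nome x * nome y = nome (x + y) := (nome_add x y).symm

/-- The sum of `(-1) ^ n q ^ (n ^ 2)` over the multiples of `3`. -/
noncomputable def thetaA (σ : ℂ) : ℂ := jacobiTheta₂ (1 / 2) (2 * (9 * σ))

/-- Minus the sum of `(-1) ^ n q ^ (n ^ 2)` over `n ≡ 1` modulo `3`. -/
noncomputable def thetaB (σ : ℂ) : ℂ := -∑' k : ℤ, jacobiTheta₂_term (3 * k + 1) (1 / 2) (2 * σ)

/-- At w = 1/2 the terms of n and -n agree, so the two nonzero classes contribute -B each. -/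
lemma jacobiTheta₂_half_eq {σ : ℂ} (hσ : 0 < σ.im) :
    jacobiTheta₂ (1 / 2) (2 * σ) = thetaA σ - 2 * thetaB σ := by
  have hs := (summable_jacobiTheta₂_term_iff (1 / 2) _).mpr (im_nat_mul_pos hσ two_ne_zero)
  push_cast at hs
  rw [jacobiTheta₂, tsum_int_mod_three hs, thetaA, jacobiTheta₂, thetaB]
  have h1 : ∀ k : ℤ, jacobiTheta₂_term (3 * k) (1 / 2) (2 * σ) =
      jacobiTheta₂_term k (1 / 2) (2 * (9 * σ)) := fun k => by
    simp only [jacobiTheta₂_term_eq_nome]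
    exact nome_eq_of_eq_add_intCast k (by push_cast; ring)
  have h2 : ∀ k : ℤ, jacobiTheta₂_term (-(3 * k + 1)) (1 / 2) (2 * σ) =
      jacobiTheta₂_term (3 * k + 1) (1 / 2) (2 * σ) := fun k => by
    simp only [jacobiTheta₂_term_eq_nome]
    exact nome_eq_of_eq_add_intCast (-(3 * k + 1)) (by push_cast; ring)
  simp_rw [h1, h2]
  ring

/-- The extra 1/3 weights the classes of 1 and -1 by ω and ω², whose sum is -1. -/
lemma jacobiTheta₂_five_sixths_eq {σ : ℂ} (hσ : 0 < σ.im) :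
    jacobiTheta₂ (1 / 2 + 1 / 3) (2 * σ) = thetaA σ + thetaB σ := by
  have hs := (summable_jacobiTheta₂_term_iff (1 / 2 + 1 / 3) _).mpr
    (im_nat_mul_pos hσ two_ne_zero)
  push_cast at hs
  rw [jacobiTheta₂, tsum_int_mod_three hs, thetaA, jacobiTheta₂, thetaB]
  have h1 : ∀ k : ℤ, jacobiTheta₂_term (3 * k) (1 / 2 + 1 / 3) (2 * σ) =
      jacobiTheta₂_term k (1 / 2) (2 * (9 * σ)) := fun k => by
    simp only [jacobiTheta₂_term_eq_nome]
    exact nome_eq_of_eq_add_intCast (2 * k) (by push_cast; ring)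
  have h2 : ∀ k : ℤ, jacobiTheta₂_term (3 * k + 1) (1 / 2 + 1 / 3) (2 * σ) =
      nome (1 / 3) * jacobiTheta₂_term (3 * k + 1) (1 / 2) (2 * σ) := fun k => by
    simp only [jacobiTheta₂_term_eq_nome, nome_mul_nome]
    exact nome_eq_of_eq_add_intCast k (by push_cast; ring)
  have h3 : ∀ k : ℤ, jacobiTheta₂_term (-(3 * k + 1)) (1 / 2 + 1 / 3) (2 * σ) =
      nome (1 / 3) ^ 2 * jacobiTheta₂_term (3 * k + 1) (1 / 2) (2 * σ) := fun k => by
    simp only [jacobiTheta₂_term_eq_nome, ← nome_nat_mul, nome_mul_nome]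
    exact nome_eq_of_eq_add_intCast (-(4 * k + 2)) (by push_cast; ring)
  simp_rw [h1, h2, h3, tsum_mul_left]
  linear_combination (∑' k : ℤ, jacobiTheta₂_term (3 * k + 1) (1 / 2) (2 * σ)) * one_add_nome_third

/-- The shift multiplies q^{n²} by ω^{jn²}, and n² is 0 mod 3 on the class of A and 1 on that of B.
-/
lemma thetaA_add (σ : ℂ) (j : ℕ) : thetaA (σ + j / 3) = thetaA σ := by
  refine tsum_congr fun k => ?_
  simp only [jacobiTheta₂_term_eq_nome]
  exact nome_eq_of_eq_add_intCast (3 * k ^ 2 * j) (by push_cast; ring)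

lemma thetaB_add (σ : ℂ) (j : ℕ) : thetaB (σ + j / 3) = nome (1 / 3) ^ j * thetaB σ := by
  rw [thetaB, thetaB, mul_neg, ← tsum_mul_left]
  congr 1
  refine tsum_congr fun k => ?_
  simp only [jacobiTheta₂_term_eq_nome, ← nome_nat_mul, nome_mul_nome]
  exact nome_eq_of_eq_add_intCast ((3 * k ^ 2 + 2 * k) * j) (by push_cast; ring)

/-! ### Theta functions of the cosets of A₂ and the cube of the Euler product -/

/-- The theta function of a coset of `A₂` in its dual, in coordinates. -/
noncomputable def latSum (s : ℤ) (τ : ℂ) : ℂ :=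
  -- Projecting an integral vector with coordinate sum s to the plane of sum 0 lowers its squared
  -- norm by s²/3.
  ∑' p : ℤ × ℤ, nome (τ * (((p.1 : ℂ) ^ 2 + p.2 ^ 2 + (s - p.1 - p.2) ^ 2) / 2 - s ^ 2 / 6))

/-- Adding (k, k, k) to an integral vector does not change its projection. -/
lemma latSum_add_three_mul (s k : ℤ) (τ : ℂ) : latSum (s + 3 * k) τ = latSum s τ := by
  rw [latSum, latSum, ← (Equiv.addRight ((k, k) : ℤ × ℤ)).tsum_eq]
  refine tsum_congr fun p => ?_
  congr 2
  simp
  ring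

lemma latSum_neg (s : ℤ) (τ : ℂ) : latSum (-s) τ = latSum s τ := by
  rw [latSum, latSum, ← (Equiv.neg (ℤ × ℤ)).tsum_eq]
  refine tsum_congr fun p => ?_
  congr 2
  simp
  ring

lemma latSum_of_dvd {s : ℤ} (h : 3 ∣ s) (τ : ℂ) : latSum s τ = latSum 0 τ := by
  obtain ⟨k, rfl⟩ := h
  simpa using latSum_add_three_mul 0 k τ

lemma latSum_of_not_dvd {s : ℤ} (h : ¬ 3 ∣ s) (τ : ℂ) : latSum s τ = latSum 1 τ := by
  obtain ⟨k, rfl | rfl⟩ : ∃ k : ℤ, s = 1 + 3 * k ∨ s = -1 + 3 * k := ⟨(s + 1) / 3, by omega⟩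
  · exact latSum_add_three_mul 1 k τ
  · rw [latSum_add_three_mul, latSum_neg]

lemma latSum_add (s : ℤ) (τ : ℂ) (j : ℕ) :
    latSum s (τ + j) = nome (s ^ 2 / 3) ^ j * latSum s τ := by
  rw [latSum, latSum, ← tsum_mul_left]
  refine tsum_congr fun p => ?_
  rw [← nome_nat_mul, nome_mul_nome]
  exact nome_eq_of_eq_add_intCast
    (j * (p.1 ^ 2 + p.2 ^ 2 + p.1 * p.2 - s * p.1 - s * p.2)) (by push_cast; ring)

/-- The factor depending only on `a + b + c = s` in a product of three pentagonal terms. -/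
lemma pentagonal_mul_mul (s a b : ℤ) (σ : ℂ) :
    jacobiTheta₂_term (s - a - b) (1 / 2 + σ / 2) (3 * σ) *
      (jacobiTheta₂_term a (1 / 2 + σ / 2) (3 * σ) * jacobiTheta₂_term b (1 / 2 + σ / 2) (3 * σ)) =
    jacobiTheta₂_term s (1 / 2 + σ / 2) σ *
      nome (3 * σ * (((a : ℂ) ^ 2 + b ^ 2 + (s - a - b) ^ 2) / 2 - s ^ 2 / 6)) := by
  simp only [jacobiTheta₂_term_eq_nome, nome_mul_nome]
  congr 1
  push_cast
  ring

/-- The bijection `(s, a, b) ↦ (s - a - b, a, b)`. -/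
def tripleSumEquiv : ℤ × (ℤ × ℤ) ≃ ℤ × (ℤ × ℤ) where
  toFun p := (p.1 - p.2.1 - p.2.2, p.2)
  invFun p := (p.1 + p.2.1 + p.2.2, p.2)
  left_inv p := Prod.ext (by dsimp only; ring) rfl
  right_inv p := Prod.ext (by dsimp only; ring) rfl

lemma summable_norm_pentagonal_mul_mul {σ : ℂ} (hσ : 0 < σ.im) :
    Summable fun p : ℤ × (ℤ × ℤ) => ‖jacobiTheta₂_term p.1 (1 / 2 + σ / 2) σ *
      nome (3 * σ * (((p.2.1 : ℂ) ^ 2 + p.2.2 ^ 2 + (p.1 - p.2.1 - p.2.2) ^ 2) / 2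
        - p.1 ^ 2 / 6))‖ := by
  have ht := ((summable_jacobiTheta₂_term_iff (1 / 2 + σ / 2) _).mpr
    (im_nat_mul_pos hσ three_ne_zero)).norm
  push_cast at ht
  have h := tripleSumEquiv.summable_iff.mpr (ht.mul_norm (ht.mul_norm ht))
  refine h.congr fun p => ?_
  rw [← pentagonal_mul_mul]
  rfl

/-- This is the slice of the triple pentagonal family at fixed s, with σ = τ/3, after cancelling a
nonzero factor. -/
lemma summable_norm_latSum (s : ℤ) {τ : ℂ} (hτ : 0 < τ.im) :
    Summable fun p : ℤ × ℤ =>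
      ‖nome (τ * (((p.1 : ℂ) ^ 2 + p.2 ^ 2 + (s - p.1 - p.2) ^ 2) / 2 - s ^ 2 / 6))‖ := by
  have h3 : 0 < (τ / 3).im := by
    rw [show τ / 3 = ((1 / 3 : ℝ) : ℂ) * τ by push_cast; ring, Complex.im_ofReal_mul]
    positivity
  have h := (summable_norm_pentagonal_mul_mul h3).prod_factor s
  simp only [norm_mul, jacobiTheta₂_term_eq_nome] at h
  rw [summable_mul_left_iff (norm_ne_zero_iff.mpr (by exact Complex.exp_ne_zero _))] at h
  refine h.congr fun p => ?_
  rw [show 3 * (τ / 3) = τ by ring]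

/-- `E(q) ^ 3 = E(q ^ 3) (a - c)`, where `a` and `c` are the theta functions of `A₂` and of its
nontrivial coset, at the nome `q ^ 3`. -/
lemma eulerProd_pow_three {σ : ℂ} (hσ : 0 < σ.im) :
    eulerProd (nome σ) ^ 3 =
      eulerProd (nome (3 * σ)) * (latSum 0 (3 * σ) - latSum 1 (3 * σ)) := by
  have ht := ((summable_jacobiTheta₂_term_iff (1 / 2 + σ / 2) _).mpr
    (im_nat_mul_pos hσ three_ne_zero)).norm
  push_cast at ht
  have hsum := (summable_norm_pentagonal_mul_mul hσ).of_norm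
  have hg := (summable_jacobiTheta₂_term_iff (1 / 2 + σ / 2) _).mpr hσ
  -- Cube the pentagonal series and group the triples of indices by their sum s.
  have e1 : eulerProd (nome σ) ^ 3 =
      ∑' s : ℤ, jacobiTheta₂_term s (1 / 2 + σ / 2) σ * latSum s (3 * σ) := by
    rw [← jacobiTheta₂_pentagonal hσ, pow_succ', sq, jacobiTheta₂,
      tsum_mul_tsum_of_summable_norm ht ht, tsum_mul_tsum_of_summable_norm ht (ht.mul_norm ht),
      ← tripleSumEquiv.tsum_eq]
    simp only [tripleSumEquiv, Equiv.coe_fn_mk, pentagonal_mul_mul]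
    rw [hsum.tsum_prod]
    simp only [tsum_mul_left, latSum]
  have hg' : Summable fun s : ℤ => jacobiTheta₂_term s (1 / 2 + σ / 2) σ * latSum s (3 * σ) := by
    have := hsum.prod
    simpa only [tsum_mul_left, latSum] using this
  have d : ∀ k : ℤ, latSum (3 * k) (3 * σ) = latSum 0 (3 * σ) :=
    fun k => latSum_of_dvd (by omega) _
  have d1 : ∀ k : ℤ, latSum (3 * k + 1) (3 * σ) = latSum 1 (3 * σ) :=
    fun k => latSum_of_not_dvd (by omega) _
  -- The terms are antisymmetric under s ↦ -1 - s.
  have e2 : ∑' s : ℤ, jacobiTheta₂_term s (1 / 2 + σ / 2) σ = 0 := by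
    rw [← self_eq_neg, ← tsum_neg, ← (Equiv.subLeft (-1 : ℤ)).tsum_eq]
    refine tsum_congr fun s => ?_
    rw [neg_eq_neg_one_mul (jacobiTheta₂_term s _ _), ← nome_half]
    simp only [jacobiTheta₂_term_eq_nome, nome_mul_nome]
    exact nome_eq_of_eq_add_intCast (-1 - s) (by simp; ring)
  have e3 : ∑' k : ℤ, jacobiTheta₂_term (3 * k) (1 / 2 + σ / 2) σ = eulerProd (nome (3 * σ)) := by
    have h3 := jacobiTheta₂_pentagonal (im_nat_mul_pos hσ three_ne_zero)
    push_cast at h3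
    rw [← h3]
    refine tsum_congr fun k => ?_
    simp only [jacobiTheta₂_term_eq_nome]
    exact nome_eq_of_eq_add_intCast k (by push_cast; ring)
  -- The multiples of 3 sum to E(q³), q the nome of σ, so the other two classes together sum to
  -- -E(q³); this is the coefficient of T₁.
  rw [tsum_int_mod_three hg, e3] at e2
  rw [e1, tsum_int_mod_three hg']
  simp only [latSum_neg, d, d1, tsum_mul_right]
  rw [e3]
  linear_combination latSum 1 (3 * σ) * e2

/-! ### Eta quotients and the algebra of A, B, φ -/

lemma eta_eq (z : ℂ) : ModularForm.eta z = nome (z / 24) * eulerProd (nome z) := by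
  rw [ModularForm.eta, eulerProd]
  congr 1
  · rw [Function.Periodic.qParam, nome]; push_cast; ring_nf
  · exact tprod_congr fun n => by rw [ModularForm.eta_q_eq_pow]; rfl

/-- The exponents are such that the fractional powers of q cancel; every eta quotient in the formula
or its inverse has this shape. -/
lemma eta_pow_div_eta_pow (z : ℂ) (n : ℕ) :
    ModularForm.eta (2 * z) ^ n / ModularForm.eta z ^ (2 * n) =
      eulerProd (nome z ^ 2) ^ n / eulerProd (nome z) ^ (2 * n) := by
  have h : nome (2 * z / 24) ^ n = nome (z / 24) ^ (2 * n) := by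
    rw [← nome_nat_mul, ← nome_nat_mul]; push_cast; ring_nf
  have h2 : nome (2 * z) = nome z ^ 2 := by rw [← nome_nat_mul]; rfl
  rw [eta_eq, eta_eq, mul_pow, mul_pow, h, h2]
  exact mul_div_mul_left _ _ (pow_ne_zero _ (Complex.exp_ne_zero _))

lemma theta_algebra {ω A B φ T₀ T₁ : ℂ} (hω : 1 + ω + ω ^ 2 = 0) (hA : A ≠ 0) (hφ : φ ≠ 0)
    (hD : A * (A ^ 3 - 8 * B ^ 3) = φ ^ 4) (hT₀ : T₀ * φ = A ^ 3 + 4 * B ^ 3)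
    (hT₁ : T₁ * φ = 3 * A ^ 2 * B) :
    T₀ * T₀ = 1 / 4 * φ ^ 6 *
        (1 / A ^ 2 + ∑ j ∈ range 3, 1 / (A - 2 * (ω ^ j * B)) ^ 2) ∧
      T₀ * T₁ = 1 / 4 * φ ^ 6 * ∑ j ∈ range 3, ω ^ (2 * j) * (1 / (A - 2 * (ω ^ j * B)) ^ 2) ∧
      T₁ * T₁ = 1 / 4 * φ ^ 6 * ∑ j ∈ range 3, ω ^ j * (1 / (A - 2 * (ω ^ j * B)) ^ 2) := by
  have hω3 : ω ^ 3 = 1 := by linear_combination (ω - 1) * hω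
  have hDD : φ ^ 8 = A ^ 2 * (A ^ 3 - 8 * B ^ 3) ^ 2 := by
    linear_combination (-φ ^ 4 - A * (A ^ 3 - 8 * B ^ 3)) * hD
  -- The cᵢ are the coefficients of A²(A² + 2Ax + 4x²)² at x = ω^jB, reduced by (ω^j)³ = 1. Summing
  -- over j with weights 1, ω^{2j}, ω^j extracts 3c₀, 3c₁, 3c₂.
  set c₀ := A ^ 2 * (A ^ 4 + 16 * A * B ^ 3) with hc₀
  set c₁ := A ^ 2 * (4 * A ^ 3 * B + 16 * B ^ 4) with hc₁
  set c₂ := A ^ 2 * (12 * A ^ 2 * B ^ 2) with hc₂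
  have hinv : ∀ j, 1 / (A - 2 * (ω ^ j * B)) ^ 2 =
      (c₀ + c₁ * ω ^ j + c₂ * ω ^ (2 * j)) / φ ^ 8 := fun j => by
    have hj : (ω ^ j) ^ 3 = 1 := by rw [← pow_mul, mul_comm, pow_mul, hω3, one_pow]
    have h : (A - 2 * (ω ^ j * B)) * (A * (A ^ 2 + 2 * A * (ω ^ j * B) + 4 * (ω ^ j * B) ^ 2)) =
        φ ^ 4 := by linear_combination hD - 8 * A * B ^ 3 * hj
    have h0 : A - 2 * (ω ^ j * B) ≠ 0 := fun h0 => by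
      rw [h0, zero_mul] at h
      exact pow_ne_zero 4 hφ h.symm
    have hv : c₀ + c₁ * ω ^ j + c₂ * ω ^ (2 * j) =
        (A * (A ^ 2 + 2 * A * (ω ^ j * B) + 4 * (ω ^ j * B) ^ 2)) ^ 2 := by
      rw [mul_comm 2 j, pow_mul]
      linear_combination -(16 * A ^ 3 * B ^ 3 + 16 * A ^ 2 * B ^ 4 * ω ^ j) * hj
    rw [div_eq_div_iff (pow_ne_zero 2 h0) (pow_ne_zero 8 hφ), one_mul, hv, ← mul_pow,
      mul_comm _ (A - _), h]
    ring
  have hA2 : 1 / A ^ 2 = (A ^ 3 - 8 * B ^ 3) ^ 2 / φ ^ 8 := by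
    rw [hDD, div_eq_div_iff (pow_ne_zero 2 hA) (hDD ▸ pow_ne_zero 8 hφ)]
    ring
  have e0 : T₀ = (A ^ 3 + 4 * B ^ 3) / φ := by rw [eq_div_iff hφ, hT₀]
  have e1 : T₁ = 3 * A ^ 2 * B / φ := by rw [eq_div_iff hφ, hT₁]
  simp only [sum_range_succ, sum_range_zero, zero_add, hinv]
  refine ⟨?_, ?_, ?_⟩
  · rw [hA2, e0, ← add_div, ← add_div, ← add_div]
    -- The δ-term is what completes 3c₀ to a perfect square.
    have : (A ^ 3 - 8 * B ^ 3) ^ 2 + (c₀ + c₁ * ω ^ 0 + c₂ * ω ^ (2 * 0) +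
        (c₀ + c₁ * ω ^ 1 + c₂ * ω ^ (2 * 1)) + (c₀ + c₁ * ω ^ 2 + c₂ * ω ^ (2 * 2))) =
        4 * (A ^ 3 + 4 * B ^ 3) ^ 2 := by
      linear_combination (c₁ + c₂) * hω + c₂ * ω * hω3
    rw [this]
    field_simp
  · have : ω ^ (2 * 0) * ((c₀ + c₁ * ω ^ 0 + c₂ * ω ^ (2 * 0)) / φ ^ 8) +
        ω ^ (2 * 1) * ((c₀ + c₁ * ω ^ 1 + c₂ * ω ^ (2 * 1)) / φ ^ 8) +
        ω ^ (2 * 2) * ((c₀ + c₁ * ω ^ 2 + c₂ * ω ^ (2 * 2)) / φ ^ 8) = 3 * c₁ / φ ^ 8 := by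
      linear_combination ((c₀ + c₂) * hω + (c₀ * ω + c₁ * (ω ^ 3 + 2) +
        c₂ * (ω + ω ^ 2 * (ω ^ 3 + 1))) * hω3) / φ ^ 8
    rw [e0, e1, this]
    field_simp
    ring
  · have : ω ^ 0 * ((c₀ + c₁ * ω ^ 0 + c₂ * ω ^ (2 * 0)) / φ ^ 8) +
        ω ^ 1 * ((c₀ + c₁ * ω ^ 1 + c₂ * ω ^ (2 * 1)) / φ ^ 8) +
        ω ^ 2 * ((c₀ + c₁ * ω ^ 2 + c₂ * ω ^ (2 * 2)) / φ ^ 8) = 3 * c₂ / φ ^ 8 := by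
      linear_combination ((c₀ + c₁) * hω + (c₁ * ω + c₂ * (ω ^ 3 + 2)) * hω3) / φ ^ 8
    rw [e1, this]
    field_simp
    ring

/-- The theta functions of `A₂` and its nontrivial coset, as well as the Euler products occurring
in the formula, in terms of three functions `A`, `B` and `φ`. -/
lemma exists_dissection {τ : ℂ} (hτ : 0 < τ.im) :
    ∃ A B φ : ℂ, A ≠ 0 ∧ φ ≠ 0 ∧ A * (A ^ 3 - 8 * B ^ 3) = φ ^ 4 ∧
      latSum 0 τ * φ = A ^ 3 + 4 * B ^ 3 ∧ latSum 1 τ * φ = 3 * A ^ 2 * B ∧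
      φ ^ 6 = ModularForm.eta τ ^ 12 / ModularForm.eta (2 * τ) ^ 6 ∧
      1 / A ^ 2 = ModularForm.eta (6 * τ) ^ 2 / ModularForm.eta (3 * τ) ^ 4 ∧
      ∀ j : ℕ, 1 / (A - 2 * (nome (1 / 3) ^ j * B)) ^ 2 =
        ModularForm.eta (2 * ((τ + j) / 3)) ^ 2 / ModularForm.eta ((τ + j) / 3) ^ 4 := by
  set ω := nome (1 / 3) with hω
  have hω1 : 1 + ω + ω ^ 2 = 0 := one_add_nome_third
  have hω3 : ω ^ 3 = 1 := nome_third_pow_three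
  have him : ∀ j : ℕ, 0 < ((τ + j) / 3).im := fun j => by
    rw [show (τ + j) / 3 = ((1 / 3 : ℝ) : ℂ) * (τ + j) by push_cast; ring, Complex.im_ofReal_mul]
    simp [hτ]
  have hE : ∀ {z : ℂ}, 0 < z.im → ∀ {n : ℕ}, n ≠ 0 → eulerProd (nome z ^ n) ≠ 0 := fun hz _ hn =>
    eulerProd_ne_zero (norm_pow_lt_one (norm_nome_lt_one hz) hn)
  have hσ : ∀ j : ℕ, (τ + j) / 3 = τ / 3 + j / 3 := fun j => by ring
  have hQ : ∀ j : ℕ, nome ((τ + j) / 3) = ω ^ j * nome (τ / 3) := fun j => by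
    rw [hω, ← nome_nat_mul, nome_mul_nome]; ring_nf
  have hQ3 : nome (τ / 3) ^ 3 = nome τ := by rw [← nome_nat_mul]; push_cast; ring_nf
  have hQj3 : ∀ j : ℕ, nome ((τ + j) / 3) ^ 3 = nome τ := fun j => by
    rw [hQ, mul_pow, hQ3, ← pow_mul, mul_comm j, pow_mul, hω3, one_pow, one_mul]
  have hQj6 : ∀ j : ℕ, nome ((τ + j) / 3) ^ 6 = nome τ ^ 2 := fun j => by
    rw [← hQj3 j, ← pow_mul]
  have hτ3 : 0 < (τ / 3).im := by simpa using him 0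
  set A := thetaA (τ / 3) with hA
  set B := thetaB (τ / 3) with hB
  have h1 : ∀ j : ℕ, (A - 2 * (ω ^ j * B)) * eulerProd (nome ((τ + j) / 3) ^ 2) =
      eulerProd (nome ((τ + j) / 3)) ^ 2 := fun j => by
    rw [← jacobiTheta₂_half_mul_eulerProd (him j), jacobiTheta₂_half_eq (him j), hσ, thetaA_add,
      thetaB_add]
  have h2 : ∀ j : ℕ, (A + ω ^ j * B) * (eulerProd (nome ((τ + j) / 3)) * eulerProd (nome τ ^ 2)) =
      eulerProd (nome ((τ + j) / 3) ^ 2) ^ 2 * eulerProd (nome τ) := fun j => by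
    have := jacobiTheta₂_five_sixths_mul_eulerProd (him j)
    rwa [jacobiTheta₂_five_sixths_eq (him j), hQj3, hQj6, hσ, thetaA_add, thetaB_add, ← hσ] at this
  have h3 : ∀ j : ℕ, eulerProd (nome ((τ + j) / 3)) ^ 3 =
      eulerProd (nome τ) * (latSum 0 τ - ω ^ j * latSum 1 τ) := fun j => by
    have := eulerProd_pow_three (him j)
    rw [show 3 * ((τ + j) / 3) = τ + j by ring, latSum_add, latSum_add,
      nome_eq_of_eq_add_intCast (x := τ + j) (y := τ) j (by simp)] at this
    have e : nome (((0 : ℤ) : ℂ) ^ 2 / 3) = 1 := by simp [nome]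
    rw [e] at this
    rw [this]
    simp [hω]
  have h4 : A * eulerProd (nome τ ^ 6) = eulerProd (nome τ ^ 3) ^ 2 := by
    have := jacobiTheta₂_half_mul_eulerProd (im_nat_mul_pos hτ three_ne_zero)
    rw [nome_nat_mul, ← pow_mul] at this
    rw [hA, thetaA, show 9 * (τ / 3) = ((3 : ℕ) : ℂ) * τ by push_cast; ring]
    exact this
  have hQ9 : nome (τ / 3) ^ 9 = nome τ ^ 3 := by rw [← hQ3, ← pow_mul]
  have h5 : eulerProd (nome ((τ + (0 : ℕ)) / 3)) * eulerProd (nome ((τ + (1 : ℕ)) / 3)) *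
      eulerProd (nome ((τ + (2 : ℕ)) / 3)) * eulerProd (nome τ ^ 3) = eulerProd (nome τ) ^ 4 := by
    have := prod_three_eulerProd hω1 (norm_nome_lt_one hτ3)
    rw [hQ9, hQ3] at this
    simpa only [hQ, pow_zero, one_mul, pow_one] using this
  have h6 : eulerProd (nome ((τ + (0 : ℕ)) / 3) ^ 2) * eulerProd (nome ((τ + (1 : ℕ)) / 3) ^ 2) *
      eulerProd (nome ((τ + (2 : ℕ)) / 3) ^ 2) * eulerProd (nome τ ^ 6) =
      eulerProd (nome τ ^ 2) ^ 4 := by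
    -- The base is now Q², on which Q ↦ ωQ acts by ω².
    have := prod_three_eulerProd (ζ := ω ^ 2) (by linear_combination hω1 + ω * hω3)
      (norm_pow_lt_one (norm_nome_lt_one hτ3) two_ne_zero)
    rw [pow_right_comm _ 2 9, pow_right_comm _ 2 3, hQ9, hQ3, ← pow_mul (nome τ)] at this
    simpa only [hQ, pow_zero, one_mul, pow_one, mul_pow] using this
  have x0 : ∀ j : ℕ, eulerProd (nome ((τ + j) / 3)) ≠ 0 := fun j => by
    simpa using hE (him j) one_ne_zero
  have y0 : ∀ j : ℕ, eulerProd (nome ((τ + j) / 3) ^ 2) ≠ 0 := fun j => hE (him j) two_ne_zero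
  have n1 : eulerProd (nome τ) ≠ 0 := by simpa using hE hτ one_ne_zero
  have n2 : eulerProd (nome τ ^ 2) ≠ 0 := hE hτ two_ne_zero
  have n3 : eulerProd (nome τ ^ 3) ≠ 0 := hE hτ three_ne_zero
  have n6 : eulerProd (nome τ ^ 6) ≠ 0 := hE hτ (by norm_num)
  have hu : ∀ j : ℕ, A - 2 * (ω ^ j * B) =
      eulerProd (nome ((τ + j) / 3)) ^ 2 / eulerProd (nome ((τ + j) / 3) ^ 2) := fun j => by
    rw [eq_div_iff (y0 j), h1]
  have hA' : A = eulerProd (nome τ ^ 3) ^ 2 / eulerProd (nome τ ^ 6) := by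
    rw [eq_div_iff n6, h4]
  set φ := eulerProd (nome τ) ^ 2 / eulerProd (nome τ ^ 2) with hφ
  have hT : ∀ j : ℕ, (latSum 0 τ - ω ^ j * latSum 1 τ) * φ =
      A ^ 3 + 4 * B ^ 3 - ω ^ j * (3 * A ^ 2 * B) := fun j => by
    have hj : (ω ^ j) ^ 3 = 1 := by rw [← pow_mul, mul_comm, pow_mul, hω3, one_pow]
    have e1 : A ^ 3 + 4 * B ^ 3 - ω ^ j * (3 * A ^ 2 * B) =
        (A + ω ^ j * B) * (A - 2 * (ω ^ j * B)) ^ 2 := by linear_combination -4 * B ^ 3 * hj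
    have e2 : A + ω ^ j * B = eulerProd (nome ((τ + j) / 3) ^ 2) ^ 2 * eulerProd (nome τ) /
        (eulerProd (nome ((τ + j) / 3)) * eulerProd (nome τ ^ 2)) := by
      rw [eq_div_iff (mul_ne_zero (x0 j) n2), h2]
    have e3 : latSum 0 τ - ω ^ j * latSum 1 τ =
        eulerProd (nome ((τ + j) / 3)) ^ 3 / eulerProd (nome τ) := by
      rw [h3]; field_simp
    rw [e1, e2, e3, hu, hφ]
    have := x0 j
    have := y0 j
    field_simp
  have hω' : ω - 1 ≠ 0 := fun h => by
    have : ω = 1 := by linear_combination h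
    rw [this] at hω1
    norm_num at hω1
  have hT1 : latSum 1 τ * φ = 3 * A ^ 2 * B := by
    -- The relations for j = 0 and j = 1 already separate T₀ and T₁, as ω ≠ 1.
    refine mul_left_cancel₀ hω' ?_
    linear_combination hT 0 - hT 1
  refine ⟨A, B, φ, ?_, ?_, ?_, ?_, hT1, ?_, ?_, fun j => ?_⟩
  · rw [hA']; exact div_ne_zero (pow_ne_zero _ n3) n6
  · exact div_ne_zero (pow_ne_zero _ n1) n2
  · have e : A ^ 3 - 8 * B ^ 3 =
        (A - 2 * (ω ^ 0 * B)) * (A - 2 * (ω ^ 1 * B)) * (A - 2 * (ω ^ 2 * B)) := by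
      linear_combination (2 * A ^ 2 * B - 4 * A * B ^ 2 * ω) * hω1 + 8 * B ^ 3 * hω3
    have d : φ ^ 4 = A * ((eulerProd (nome τ) ^ 4 / eulerProd (nome τ ^ 3)) ^ 2 /
        (eulerProd (nome τ ^ 2) ^ 4 / eulerProd (nome τ ^ 6))) := by
      rw [hA', hφ]; field_simp
    have := x0 0
    have := x0 1
    have := x0 2
    have := y0 0
    have := y0 1
    have := y0 2
    rw [e, d, ← h5, ← h6, hu, hu, hu]
    field_simp
  · linear_combination hT 0 + hT1
  · rw [hφ, div_pow, ← pow_mul, ← inv_inj, inv_div, inv_div]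
    exact (eta_pow_div_eta_pow τ 6).symm
  · have := eta_pow_div_eta_pow (3 * τ) 2
    have e : nome (3 * τ) = nome τ ^ 3 := by rw [← nome_nat_mul]; rfl
    rw [show 2 * (3 * τ) = 6 * τ by ring, e, ← pow_mul] at this
    rw [hA', this]
    field_simp
  · rw [hu, eta_pow_div_eta_pow _ 2, div_pow, one_div_div, ← pow_mul]

/-! ### From lattice cosets to coordinate sums -/

namespace CosetTheta

section
variable {E F : Type*} [NormedAddCommGroup E] [InnerProductSpace ℝ E]
  [NormedAddCommGroup F] [InnerProductSpace ℝ F]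

lemma thetaTerm_eq_nome (x : E) (τ : ℂ) :
    thetaTerm x τ = nome (τ * ((inner ℝ x x / 2 : ℝ) : ℂ)) := by
  rw [thetaTerm, nome]; ring_nf

lemma thetaTerm_prod (x : WithLp 2 (E × F)) (τ : ℂ) :
    thetaTerm x τ = thetaTerm x.fst τ * thetaTerm x.snd τ := by
  rw [thetaTerm_eq_nome, thetaTerm_eq_nome, thetaTerm_eq_nome, nome_mul_nome,
    WithLp.prod_inner_apply]
  congr 1
  simp only [WithLp.ofLp_fst, WithLp.ofLp_snd]
  push_cast
  ring

/-- The elements of an orthogonal direct sum as pairs. -/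
def orthSumEquiv (L : Submodule ℤ E) (M : Submodule ℤ F) : orthSum L M ≃ L × M where
  toFun x := (⟨x.1.fst, x.2.1⟩, ⟨x.1.snd, x.2.2⟩)
  invFun p := ⟨WithLp.toLp 2 (p.1.1, p.2.1), p.1.2, p.2.2⟩
  left_inv _ := rfl
  right_inv _ := rfl

lemma hasSum_thetaTerm_orthSum {L : Submodule ℤ E} {M : Submodule ℤ F}
    (r : WithLp 2 (E × F)) (τ : ℂ)
    (hL : Summable fun v : L => ‖thetaTerm (r.fst + (v : E)) τ‖)
    (hM : Summable fun v : M => ‖thetaTerm (r.snd + (v : F)) τ‖) :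
    HasSum (fun v : orthSum L M => thetaTerm (r + (v : WithLp 2 (E × F))) τ)
      (theta r.fst L τ * theta r.snd M τ) := by
  have h : HasSum (fun p : L × M => thetaTerm (r.fst + (p.1 : E)) τ *
      thetaTerm (r.snd + (p.2 : F)) τ) (theta r.fst L τ * theta r.snd M τ) := by
    rw [theta, theta, tsum_mul_tsum_of_summable_norm hL hM]
    exact (hL.mul_norm hM).of_norm.hasSum
  refine ((orthSumEquiv L M).hasSum_iff.mpr h).congr_fun fun v => ?_
  rw [thetaTerm_prod]
  rfl

end

/-- The element `(a, b, -a - b)` of `A₂`. -/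
def A2.mk (p : ℤ × ℤ) : A2 :=
  ⟨!₂[(p.1 : ℝ), (p.2 : ℝ), ((-p.1 - p.2 : ℤ) : ℝ)], fun i => by
    fin_cases i
    exacts [⟨p.1, rfl⟩, ⟨p.2, rfl⟩, ⟨-p.1 - p.2, rfl⟩], by simp [Fin.sum_univ_three]⟩

lemma A2.mk_bijective : Function.Bijective A2.mk := by
  constructor
  · intro p p' h
    have h0 := congrArg (fun v : A2 => (v : EuclideanSpace ℝ (Fin 3)) 0) h
    have h1 := congrArg (fun v : A2 => (v : EuclideanSpace ℝ (Fin 3)) 1) h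
    simp [A2.mk] at h0 h1
    exact Prod.ext h0 h1
  · rintro ⟨x, hx, hx0⟩
    obtain ⟨a, ha⟩ := hx 0
    obtain ⟨b, hb⟩ := hx 1
    refine ⟨(a, b), Subtype.ext ?_⟩
    ext i
    rw [Fin.sum_univ_three] at hx0
    fin_cases i
    · simp [A2.mk, ha]
    · simp [A2.mk, hb]
    · simp [A2.mk]
      linarith

lemma sum_eq_zero_of_mem_span {x : EuclideanSpace ℝ (Fin 3)}
    (hx : x ∈ Submodule.span ℝ (A2 : Set (EuclideanSpace ℝ (Fin 3)))) : ∑ i, x i = 0 := by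
  induction hx using Submodule.span_induction with
  | mem x h => exact h.2
  | zero => simp
  | add x y _ _ hx hy => simp [sum_add_distrib, hx, hy]
  | smul c x _ hx => simp [← mul_sum, hx]

/-- Elements of the dual of `A₂` are the orthogonal projections of integral vectors. -/
lemma exists_int_of_mem_dual_A2 {x : EuclideanSpace ℝ (Fin 3)} (hx : x ∈ dual A2) :
    ∃ a b c : ℤ, x 0 = a - ((a + b + c : ℤ) : ℝ) / 3 ∧ x 1 = b - ((a + b + c : ℤ) : ℝ) / 3 ∧
      x 2 = c - ((a + b + c : ℤ) : ℝ) / 3 := by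
  have h0 := sum_eq_zero_of_mem_span hx.1
  obtain ⟨m, hm⟩ := hx.2 _ (A2.mk (1, -1)).2
  obtain ⟨k, hk⟩ := hx.2 _ (A2.mk (1, 0)).2
  simp [A2.mk, PiLp.inner_apply, Fin.sum_univ_three] at hm hk
  rw [Fin.sum_univ_three] at h0
  -- Since m = x₀ - x₁ and k = x₀ - x₂, the witness is x - x₀(1, 1, 1).
  refine ⟨0, -m, -k, ?_, ?_, ?_⟩ <;> push_cast <;> linarith

lemma inner_self_eq (x : EuclideanSpace ℝ (Fin 3)) :
    inner ℝ x x = x 0 ^ 2 + x 1 ^ 2 + x 2 ^ 2 := by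
  rw [PiLp.inner_apply, Fin.sum_univ_three]
  simp [sq]

lemma mem_A2_iff {x : EuclideanSpace ℝ (Fin 3)} {a b c : ℤ}
    (h0 : x 0 = a - ((a + b + c : ℤ) : ℝ) / 3) (h1 : x 1 = b - ((a + b + c : ℤ) : ℝ) / 3)
    (h2 : x 2 = c - ((a + b + c : ℤ) : ℝ) / 3) : x ∈ A2 ↔ 3 ∣ a + b + c := by
  constructor
  · rintro ⟨hx, -⟩
    obtain ⟨m, hm⟩ := hx 0
    refine ⟨a - m, ?_⟩
    rw [h0] at hm
    have : ((a + b + c : ℤ) : ℝ) = ((3 * (a - m) : ℤ) : ℝ) := by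
      push_cast at hm ⊢; linarith
    exact_mod_cast this
  · rintro ⟨k, hk⟩
    rw [hk] at h0 h1 h2
    push_cast at h0 h1 h2
    refine ⟨fun i => ?_, ?_⟩
    · fin_cases i
      · exact ⟨a - k, by simp [h0]⟩
      · exact ⟨b - k, by simp [h1]⟩
      · exact ⟨c - k, by simp [h2]⟩
    · have : (a + b + c : ℝ) = 3 * k := by exact_mod_cast hk
      rw [Fin.sum_univ_three]
      linarith

/-- The shift by (a, b) makes the translated vector the projection of (p₁, p₂, s - p₁ - p₂) with s =
a + b + c. -/
lemma thetaTerm_add_A2_mk {x : EuclideanSpace ℝ (Fin 3)} {a b c : ℤ}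
    (h0 : x 0 = a - ((a + b + c : ℤ) : ℝ) / 3) (h1 : x 1 = b - ((a + b + c : ℤ) : ℝ) / 3)
    (h2 : x 2 = c - ((a + b + c : ℤ) : ℝ) / 3) (τ : ℂ) (p : ℤ × ℤ) :
    thetaTerm (x + (A2.mk (p - (a, b)) : EuclideanSpace ℝ (Fin 3))) τ =
      nome (τ * (((p.1 : ℂ) ^ 2 + p.2 ^ 2 + (((a + b + c : ℤ) : ℂ) - p.1 - p.2) ^ 2) / 2 -
        ((a + b + c : ℤ) : ℂ) ^ 2 / 6)) := by
  rw [thetaTerm_eq_nome, inner_self_eq]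
  congr 2
  simp [A2.mk, h0, h1, h2]
  ring

/-- Coordinates on `A₂` adapted to the coset of an element of its dual. -/
noncomputable def A2.shiftEquiv (p : ℤ × ℤ) : ℤ × ℤ ≃ A2 :=
  (Equiv.subRight p).trans (Equiv.ofBijective A2.mk A2.mk_bijective)

lemma summable_norm_thetaTerm_A2 {x : EuclideanSpace ℝ (Fin 3)} {a b c : ℤ}
    (h0 : x 0 = a - ((a + b + c : ℤ) : ℝ) / 3) (h1 : x 1 = b - ((a + b + c : ℤ) : ℝ) / 3)
    (h2 : x 2 = c - ((a + b + c : ℤ) : ℝ) / 3) {τ : ℂ} (hτ : 0 < τ.im) :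
    Summable fun v : A2 => ‖thetaTerm (x + (v : EuclideanSpace ℝ (Fin 3))) τ‖ := by
  rw [← (A2.shiftEquiv (a, b)).summable_iff]
  refine (summable_norm_latSum (a + b + c) hτ).congr fun p => ?_
  rw [← thetaTerm_add_A2_mk h0 h1 h2]
  rfl

lemma theta_A2_eq_latSum {x : EuclideanSpace ℝ (Fin 3)} {a b c : ℤ}
    (h0 : x 0 = a - ((a + b + c : ℤ) : ℝ) / 3) (h1 : x 1 = b - ((a + b + c : ℤ) : ℝ) / 3)
    (h2 : x 2 = c - ((a + b + c : ℤ) : ℝ) / 3) (τ : ℂ) :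
    theta x A2 τ = latSum (a + b + c) τ := by
  rw [theta, latSum, ← (A2.shiftEquiv (a, b)).tsum_eq]
  refine tsum_congr fun p => ?_
  rw [← thetaTerm_add_A2_mk h0 h1 h2]
  rfl

/-- Modulo 1, x²/2 is s²/3 with s = a + b + c, and ω^{-j} = ω^{2j}. -/
lemma nome_neg_mul_inner_self {x : EuclideanSpace ℝ (Fin 3)} {a b c : ℤ}
    (h0 : x 0 = a - ((a + b + c : ℤ) : ℝ) / 3) (h1 : x 1 = b - ((a + b + c : ℤ) : ℝ) / 3)
    (h2 : x 2 = c - ((a + b + c : ℤ) : ℝ) / 3) (j : ℕ) :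
    nome (-(j * (inner ℝ x x / 2 : ℝ))) =
      if 3 ∣ a + b + c then 1 else nome (1 / 3) ^ (2 * j) := by
  rw [inner_self_eq, h0, h1, h2]
  split_ifs with h
  · obtain ⟨k, hk⟩ := h
    rw [← nome_intCast 0]
    refine nome_eq_of_eq_add_intCast (j * (a * b + b * c + c * a - 3 * k ^ 2)) ?_
    have hk' : (c : ℂ) = 3 * k - a - b := by
      rw [show c = 3 * k - a - b by omega]; push_cast; ring
    push_cast
    rw [hk']
    ring
  · rw [← nome_nat_mul]
    obtain ⟨k, hk | hk⟩ : ∃ k : ℤ, a + b + c = 1 + 3 * k ∨ a + b + c = -1 + 3 * k :=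
      ⟨(a + b + c + 1) / 3, by omega⟩
    · refine nome_eq_of_eq_add_intCast (j * (a * b + b * c + c * a - 3 * k ^ 2 - 2 * k - 1)) ?_
      have hk' : (c : ℂ) = 1 + 3 * k - a - b := by
        rw [show c = 1 + 3 * k - a - b by omega]; push_cast; ring
      push_cast
      rw [hk']
      ring
    · refine nome_eq_of_eq_add_intCast (j * (a * b + b * c + c * a - 3 * k ^ 2 + 2 * k - 1)) ?_
      have hk' : (c : ℂ) = -1 + 3 * k - a - b := by
        rw [show c = -1 + 3 * k - a - b by omega]; push_cast; ring
      push_cast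
      rw [hk']
      ring

/-- The argument 2π/3 lies in the principal range, so the complex power has the intended meaning. -/
lemma eps_cpow (x : ℝ) : eps ^ ((-3 * x : ℝ) : ℂ) = nome (-x) := by
  have h : Complex.log eps = 2 * π * I / 3 := by
    rw [eps, Complex.log_exp]
    · simp; linarith [Real.pi_pos]
    · simp; linarith [Real.pi_pos]
  rw [Complex.cpow_def_of_ne_zero (by exact Complex.exp_ne_zero _), h, nome]
  push_cast
  ring_nf

end CosetTheta

/-! ### The theorem -/

theorem mainTheorem10
    (r : WithLp 2 (EuclideanSpace ℝ (Fin 3) × EuclideanSpace ℝ (Fin 3)))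
    (hr : r ∈ CosetTheta.orthSum (CosetTheta.dual CosetTheta.A2) (CosetTheta.dual CosetTheta.A2))
    (τ : UpperHalfPlane) :
    Summable (fun v : CosetTheta.orthSum CosetTheta.A2 CosetTheta.A2 =>
      CosetTheta.thetaTerm
        (r + (v : WithLp 2 (EuclideanSpace ℝ (Fin 3) × EuclideanSpace ℝ (Fin 3)))) (τ : ℂ)) ∧
    CosetTheta.theta r (CosetTheta.orthSum CosetTheta.A2 CosetTheta.A2) (τ : ℂ) =
      (1 / 4 : ℂ) *
        (ModularForm.eta (τ : ℂ) ^ 12 / ModularForm.eta (2 * (τ : ℂ)) ^ 6) *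
        (ModularForm.eta (6 * (τ : ℂ)) ^ 2 / ModularForm.eta (3 * (τ : ℂ)) ^ 4 *
            CosetTheta.delta (CosetTheta.orthSum CosetTheta.A2 CosetTheta.A2) r +
          ∑ j ∈ Finset.range 3,
            CosetTheta.eps ^ ((-3 * (j : ℝ) * inner ℝ r r / 2 : ℝ) : ℂ) *
              (ModularForm.eta (2 * (((τ : ℂ) + (j : ℂ)) / 3)) ^ 2 /
                ModularForm.eta (((τ : ℂ) + (j : ℂ)) / 3) ^ 4)) := by
  have hτ : 0 < (τ : ℂ).im := τ.im_pos
  obtain ⟨a, b, c, h0, h1, h2⟩ := CosetTheta.exists_int_of_mem_dual_A2 hr.1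
  obtain ⟨a', b', c', h0', h1', h2'⟩ := CosetTheta.exists_int_of_mem_dual_A2 hr.2
  have hsum := CosetTheta.hasSum_thetaTerm_orthSum r (τ : ℂ)
    (CosetTheta.summable_norm_thetaTerm_A2 h0 h1 h2 hτ)
    (CosetTheta.summable_norm_thetaTerm_A2 h0' h1' h2' hτ)
  refine ⟨hsum.summable, ?_⟩
  have hδ : CosetTheta.delta (CosetTheta.orthSum CosetTheta.A2 CosetTheta.A2) r =
      if 3 ∣ a + b + c ∧ 3 ∣ a' + b' + c' then 1 else 0 := by
    have h : r ∈ CosetTheta.orthSum CosetTheta.A2 CosetTheta.A2 ↔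
        3 ∣ a + b + c ∧ 3 ∣ a' + b' + c' :=
      and_congr (CosetTheta.mem_A2_iff h0 h1 h2) (CosetTheta.mem_A2_iff h0' h1' h2')
    simp only [CosetTheta.delta, h]
  have hε : ∀ j : ℕ, CosetTheta.eps ^ ((-3 * (j : ℝ) * inner ℝ r r / 2 : ℝ) : ℂ) =
      (if 3 ∣ a + b + c then 1 else nome (1 / 3) ^ (2 * j)) *
        (if 3 ∣ a' + b' + c' then 1 else nome (1 / 3) ^ (2 * j)) := fun j => by
    rw [← CosetTheta.nome_neg_mul_inner_self h0 h1 h2,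
      ← CosetTheta.nome_neg_mul_inner_self h0' h1' h2', nome_mul_nome,
      show -3 * (j : ℝ) * inner ℝ r r / 2 = -3 * (j * (inner ℝ r r / 2)) by ring,
      CosetTheta.eps_cpow, WithLp.prod_inner_apply]
    simp only [WithLp.ofLp_fst, WithLp.ofLp_snd]
    congr 1
    push_cast
    ring
  obtain ⟨A, B, φ, hA, hφ, hD, hT₀, hT₁, hφ6, hA2, hu⟩ := exists_dissection hτ
  obtain ⟨f0, f1, f2⟩ := theta_algebra one_add_nome_third hA hφ hD hT₀ hT₁
  rw [CosetTheta.theta, hsum.tsum_eq, CosetTheta.theta_A2_eq_latSum h0 h1 h2,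
    CosetTheta.theta_A2_eq_latSum h0' h1' h2', hδ, ← hφ6, ← hA2]
  simp_rw [hε, ← hu]
  -- The weights are 1 if both components lie in A₂, ω^{2j} if exactly one does, and ω^{4j} = ω^j if
  -- neither does; only the first case has δ = 1.
  by_cases d : 3 ∣ a + b + c <;> by_cases d' : 3 ∣ a' + b' + c'
  · rw [latSum_of_dvd d, latSum_of_dvd d', f0]
    simp [d, d']
  · rw [latSum_of_dvd d, latSum_of_not_dvd d', f1]
    simp [d, d']
  · rw [latSum_of_not_dvd d, latSum_of_dvd d', mul_comm (latSum 1 _), f1]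
    simp [d, d']
  · have hω : ∀ j : ℕ, nome (1 / 3) ^ (2 * j) * nome (1 / 3) ^ (2 * j) = nome (1 / 3) ^ j :=
      fun j => by
        rw [← pow_add, show 2 * j + 2 * j = 3 * j + j by ring, pow_add, pow_mul,
          nome_third_pow_three, one_pow, one_mul]
    rw [latSum_of_not_dvd d, latSum_of_not_dvd d', f2]
    simp only [d, d', if_false, hω, false_and, mul_zero, zero_add]
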